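/- Let $p$ be a prime, let $n \ge 2$, and let $\mathbb{F}_q$ be a field with $q = p^n$ elements. Let $d = \sum_{i=0}^{n-1} d_i p^i$ with base-$p$ digits $d_i \in \{0, 1, \ldots, p-1\}$. If $d_i > 1$ for all $i \in \{0, 1, \ldots, n-1\}$, then the monomial $X^d$ is not planar over $\mathbb{F}_q$; that is, with $F(x) = x^d$ for $x \in \mathbb{F}_q$, it is not the case that for every non-zero $\alpha \in \mathbb{F}_q$ the mapping $x \mapsto F(x+\alpha) - F(x) - F(\alpha)$ is a permutation of $\mathbb{F}_q$. -/

import Mathlib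

/-- A function `F` on a (finite) field is planar if for every non-zero `α` the mapping
`x ↦ F (x + α) - F x - F α` is a permutation. -/
def IsPlanarFunction {K : Type*} [Field K] (F : K → K) : Prop :=
  ∀ α : K, α ≠ 0 → Function.Bijective (fun x : K => F (x + α) - F x - F α)

/-- A polynomial over a (finite) field is planar if its evaluation map is planar. -/
def IsPlanarPolynomial {K : Type*} [Field K] (P : Polynomial K) : Prop :=
  IsPlanarFunction (fun x : K => P.eval x)

/-- `(a 0, …, a (n - 1))` is the base-`p` representation of `d` with `n` digits, least significant
digit first. -/
def IsBaseRepr (p n d : ℕ) (a : Fin n → ℕ) : Prop :=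
  (∀ i, a i < p) ∧ d = ∑ i, a i * p ^ (i : ℕ)

/-! Put q = p^n with p odd, and let S be a character sum over the graph of a planar F. Planarity
makes q divide S times its conjugate. In the ring of integers of ℚ(ζ_p), q is a unit times
π^(n(p-1)) with π = ζ - 1, and conjugation fixes π up to a unit, so π^(n(p-1)/2) divides S. Since
ζ^c - 1 ≡ cπ mod π², products of factors χ - 1 reduce to products of additive functionals. Hence ∑
x^A F(x)^B = 0 in K whenever the p-digit sums of A and B total less than n(p-1)/2
(`IsPlanarFunction.sum_pow_mul_pow_eq_zero`). For F = x^d this sum is -1 if A + dB is a positive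
multiple of q - 1, so such pairs have weight at least n(p-1)/2. Two pairs give incompatible bounds
on the digit sum of d; the second needs d ≡ 2 mod p - 1, which comes from the prime field. -/

/-- The character sum of a planar function times the conjugate sum is divisible by the order of
the field. -/
theorem IsPlanarFunction.card_dvd_sum_mul_sum_inv {K R : Type*} [Field K] [Fintype K] [CommRing R]
    [IsDomain R] [CharZero R] {F : K → K} (hF : IsPlanarFunction F) (χ : AddChar (K × K) R) :
    (Fintype.card K : R) ∣ (∑ x, χ (x, F x)) * ∑ x, χ⁻¹ (x, F x) := by
  classical
  by_cases hχ : χ.compAddMonoidHom (AddMonoidHom.inr K K) = 0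
  · have h1 : ∀ x, χ (x, F x) = χ.compAddMonoidHom (AddMonoidHom.inl K K) x := by
      intro x
      have h2 := DFunLike.congr_fun hχ (F x)
      simp only [AddChar.compAddMonoidHom_apply, AddMonoidHom.inr_apply,
        AddChar.zero_apply] at h2
      rw [AddChar.compAddMonoidHom_apply, AddMonoidHom.inl_apply, ← mul_one (χ (x, 0)), ← h2,
        ← AddChar.map_add_eq_mul]
      simp
    refine Dvd.dvd.mul_right ?_ _
    simp_rw [h1]
    rw [AddChar.sum_eq_ite]
    split_ifs <;> simp
  · refine dvd_of_eq ?_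
    -- For α ≠ 0 the inner sum is a nontrivial character summed over a permutation of K.
    have key : ∀ α, ∑ y, χ (α, F (y + α) - F y) = if α = 0 then (Fintype.card K : R) else 0 := by
      intro α
      split_ifs with hα
      · subst hα
        simp [← Prod.zero_eq_mk]
      · have h1 : ∀ y, χ (α, F (y + α) - F y) = χ (α, F α) *
            χ.compAddMonoidHom (AddMonoidHom.inr K K) (F (y + α) - F y - F α) := by
          intro y
          rw [AddChar.compAddMonoidHom_apply, AddMonoidHom.inr_apply, ← AddChar.map_add_eq_mul]
          simp
        simp_rw [h1]
        rw [← Finset.mul_sum, (hF α hα).sum_comp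
          (fun z => χ.compAddMonoidHom (AddMonoidHom.inr K K) z),
          AddChar.sum_eq_zero_iff_ne_zero.2 hχ, mul_zero]
    calc (Fintype.card K : R) = ∑ α, ∑ y, χ (α, F (y + α) - F y) := by simp [key]
      _ = ∑ y, ∑ α, χ (α, F (y + α) - F y) := Finset.sum_comm
      _ = ∑ y, ∑ x, χ (x, F x) * χ⁻¹ (y, F y) := by
        refine Finset.sum_congr rfl fun y _ => ?_
        rw [← Equiv.sum_comp (Equiv.addLeft y) (fun x => χ (x, F x) * χ⁻¹ (y, F y))]
        refine Finset.sum_congr rfl fun α _ => ?_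
        rw [AddChar.inv_apply, ← AddChar.map_add_eq_mul]
        simp [sub_eq_add_neg]
      _ = _ := by
        rw [Finset.sum_comm, Finset.sum_mul_sum]

/-- If the conjugate sum is the image of the sum under a ring automorphism preserving the prime
`π` up to units, the sum is divisible by the square root of the `π`-part of the field order. -/
theorem IsPlanarFunction.pow_dvd_sum {K R : Type*} [Field K] [Fintype K] [CommRing R]
    [IsDomain R] [CharZero R] {F : K → K} (hF : IsPlanarFunction F) (χ : AddChar (K × K) R)
    {π : R} (hπ : Prime π) (σ : R ≃+* R) (hσ : Associated (σ π) π)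
    (hχ : ∀ v, σ (χ v) = χ⁻¹ v) {m : ℕ} (hm : π ^ (2 * m) ∣ (Fintype.card K : R)) :
    π ^ m ∣ ∑ x, χ (x, F x) := by
  have h := hm.trans (hF.card_dvd_sum_mul_sum_inv χ)
  have h1 : ∑ x, χ⁻¹ (x, F x) = σ (∑ x, χ (x, F x)) := by
    rw [map_sum]
    exact Finset.sum_congr rfl fun x _ => (hχ _).symm
  rw [h1] at h
  set S := ∑ x, χ (x, F x)
  have h2 : emultiplicity π (σ S) = emultiplicity π S := by
    rw [emultiplicity_eq_of_associated_left hσ, emultiplicity_map_eq σ]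
  rw [pow_dvd_iff_le_emultiplicity, emultiplicity_mul hπ, h2] at h
  rw [pow_dvd_iff_le_emultiplicity]
  cases hS : emultiplicity π S with
  | top => exact le_top
  | coe k =>
    rw [hS] at h
    norm_cast at h ⊢
    omega

/-- Products of `χ (l v) - 1` over the points of the graph of a planar function. -/
theorem pow_dvd_sum_prod_sub_one {V ι R : Type*} [AddCommGroup V] [Fintype ι] [CommRing R]
    (g : ι → V) {π : R} {m : ℕ} (h : ∀ χ : AddChar V R, π ^ m ∣ ∑ x, χ (g x))
    (L : List (AddChar V R)) :
    ∀ ψ : AddChar V R, π ^ m ∣ ∑ x, ψ (g x) * (L.map fun χ => χ (g x) - 1).prod := by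
  induction L with
  | nil => simpa using h
  | cons χ L ih =>
    intro ψ
    -- ψ(χ - 1) = ψχ - ψ, which is why the induction ranges over all ψ.
    have h1 := dvd_sub (ih (ψ * χ)) (ih ψ)
    rw [← Finset.sum_sub_distrib] at h1
    refine h1.trans (dvd_of_eq (Finset.sum_congr rfl fun x _ => ?_))
    rw [List.map_cons, List.prod_cons, AddChar.mul_apply]
    ring

/-! ### Reduction modulo ζ - 1 -/

/-- A ring of integers containing a primitive `p`-th root of unity `ζ`, in which `p` is totally
ramified, with an automorphism inverting `ζ`. -/
theorem exists_cyclotomic_ring (p : ℕ) [Fact p.Prime] :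
    ∃ (R : Type) (_ : CommRing R) (_ : IsDomain R) (_ : CharZero R) (ζ : R) (σ : R ≃+* R),
      IsPrimitiveRoot ζ p ∧ Prime (ζ - 1) ∧ Associated ((ζ - 1) ^ (p - 1)) (p : R) ∧
      σ ζ * ζ = 1 := by
  have hp : p.Prime := Fact.out
  obtain ⟨K, _, _, _⟩ : ∃ (K : Type) (_ : Field K) (_ : NumberField K),
      IsCyclotomicExtension {p} ℚ K :=
    ⟨CyclotomicField p ℚ, inferInstance, inferInstance, 
      (Subsingleton.elim _ _ : CyclotomicField.algebra p ℚ = DivisionRing.toRatAlgebra) ▸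
        CyclotomicField.isCyclotomicExtension p ℚ⟩
  have hζ : IsPrimitiveRoot (IsCyclotomicExtension.zeta p ℚ K) p :=
    IsCyclotomicExtension.zeta_spec p ℚ K
  set z := IsCyclotomicExtension.zeta p ℚ K with hz
  obtain ⟨τ, hτ⟩ : ∃ τ : Gal(K/ℚ), τ z * z = 1 := by
    let e := IsCyclotomicExtension.autEquivPow (n := p) (K := ℚ) K
      (Polynomial.cyclotomic.irreducible_rat hp.pos)
    refine ⟨e.symm (-1), ?_⟩
    have h := (IsCyclotomicExtension.zeta_spec p ℚ K).autToPow_spec ℚ (e.symm (-1))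
    have h1 : (IsCyclotomicExtension.zeta_spec p ℚ K).autToPow ℚ (e.symm (-1)) = -1 :=
      e.apply_symm_apply (-1)
    rw [h1] at h
    rw [← h, ← pow_succ, ← hz, hζ.pow_eq_one_iff_dvd, ← ZMod.natCast_eq_zero_iff]
    simp
  refine ⟨NumberField.RingOfIntegers K, inferInstance, inferInstance, inferInstance,
    hζ.toInteger, NumberField.RingOfIntegers.mapRingEquiv (τ : K ≃+* K),
    hζ.toInteger_isPrimitiveRoot, hζ.zeta_sub_one_prime',
    IsCyclotomicExtension.Rat.associated_zeta_sub_one_pow_prime p hζ, ?_⟩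
  apply NumberField.RingOfIntegers.ext
  exact hτ

/-- Modulo `ζ - 1`, the quotient `(ζ ^ c - 1) / (ζ - 1)` is `c`. -/
theorem exists_pow_sub_one_eq {R : Type*} [CommRing R] (ζ : R) (c : ℕ) :
    ∃ g : R, ζ ^ c - 1 = (ζ - 1) * g ∧ ζ - 1 ∣ g - c := by
  refine ⟨∑ i ∈ Finset.range c, ζ ^ i, (mul_geom_sum ζ c).symm, ?_⟩
  have h : ∑ i ∈ Finset.range c, ζ ^ i - (c : R) = ∑ i ∈ Finset.range c, (ζ ^ i - 1) := by
    simp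
  rw [h]
  exact Finset.dvd_sum fun i _ => sub_one_dvd_pow_sub_one ζ i

/-- A natural number divisible by `ζ - 1` is divisible by `p`. -/
theorem natCast_eq_zero_of_sub_one_dvd {R : Type*} [CommRing R] {p : ℕ} [Fact p.Prime]
    {ζ : R} (hπ : Prime (ζ - 1))
    (hp : ζ - 1 ∣ (p : R)) {N : ℕ} (h : ζ - 1 ∣ (N : R)) : (N : ZMod p) = 0 := by
  rw [ZMod.natCast_eq_zero_iff]
  by_contra hN
  have h1 : IsCoprime (p : ℤ) (N : ℤ) :=
    Nat.isCoprime_iff_coprime.2 (((Fact.out : p.Prime).coprime_iff_not_dvd).2 hN)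
  obtain ⟨a, b, hab⟩ := h1
  have h2 := congrArg (Int.cast : ℤ → R) hab
  push_cast at h2
  have h3 : ζ - 1 ∣ (a : R) * p + b * N := dvd_add (hp.mul_left _) (h.mul_left _)
  exact hπ.not_isUnit (isUnit_of_dvd_one (h2 ▸ h3))

/-- Products of few additive functionals sum to zero over the graph of a planar function. -/
theorem IsPlanarFunction.sum_prod_functional_eq_zero {K : Type*} [Field K] [Fintype K] {p n h : ℕ}
    [Fact p.Prime] (hK : Fintype.card K = p ^ n) (hp : p - 1 = 2 * h) {F : K → K}
    (hF : IsPlanarFunction F) (L : List (K × K →+ ZMod p)) (hL : L.length < n * h) :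
    ∑ x, (L.map fun l => l (x, F x)).prod = 0 := by
  obtain ⟨R, _, _, _, ζ, σ, hζ, hπ, hassoc, hσ⟩ := exists_cyclotomic_ring p
  have hp0 : p.Prime := Fact.out
  have hinv : ∀ x y : R, x ^ p = 1 → x * y = 1 → σ x = y := by
    intro x y hx hxy
    obtain ⟨i, -, rfl⟩ := hζ.eq_pow_of_pow_eq_one hx
    calc σ (ζ ^ i) = σ (ζ ^ i) * (ζ ^ i * y) := by rw [hxy, mul_one]
      _ = (σ ζ * ζ) ^ i * y := by rw [map_pow]; ring
      _ = y := by rw [hσ, one_pow, one_mul]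
  have hσπ : Associated (σ (ζ - 1)) (ζ - 1) := by
    have h1 : IsUnit (-σ ζ) := (IsUnit.of_mul_eq_one _ hσ).neg
    refine Associated.symm ⟨h1.unit, ?_⟩
    rw [IsUnit.unit_spec, map_sub, map_one]
    linear_combination -hσ
  have hchar : CharP K p := by
    have hn : n ≠ 0 := by rintro rfl; simp at hL
    obtain ⟨q, hq⟩ := CharP.exists K
    obtain ⟨k, hqp, hk⟩ := FiniteField.card K q
    have : p = q := by
      rw [hK] at hk
      exact (Nat.prime_dvd_prime_iff_eq hp0 hqp).1
        (hp0.dvd_of_dvd_pow (hk ▸ dvd_pow_self p hn))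
    exact this ▸ hq
  have hsum : ∀ χ : AddChar (K × K) R, (ζ - 1) ^ (n * h) ∣ ∑ x, χ (x, F x) := by
    intro χ
    refine hF.pow_dvd_sum χ hπ σ hσπ (fun v => ?_) ?_
    · refine hinv _ _ ?_ ?_
      · rw [← AddChar.map_nsmul_eq_pow]
        have : p • v = 0 := by ext <;> simp
        rw [this, AddChar.map_zero_eq_one]
      · rw [AddChar.inv_apply, ← AddChar.map_add_eq_mul]
        simp
    · rw [hK, Nat.cast_pow]
      refine (dvd_of_eq ?_).trans (pow_dvd_pow_of_dvd hassoc.dvd n)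
      rw [← pow_mul, hp]
      congr 1
      ring
  set χ₀ := AddChar.zmodChar p hζ.pow_eq_one with hχ₀
  choose g hg1 hg2 using exists_pow_sub_one_eq (R := R) ζ
  have h1 := pow_dvd_sum_prod_sub_one (fun x => (x, F x)) hsum
    (L.map fun l => χ₀.compAddMonoidHom l) 0
  have h2 : ∀ (L : List (K × K →+ ZMod p)) (v : K × K),
      ((L.map fun l => χ₀.compAddMonoidHom l).map fun χ => χ v - 1).prod =
        (ζ - 1) ^ L.length * (L.map fun l => g (l v).val).prod := by
    intro L v
    induction L with
    | nil => simp
    | cons l L ih =>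
      simp only [List.map_cons, List.prod_cons, List.length_cons]
      rw [ih, AddChar.compAddMonoidHom_apply, hχ₀, AddChar.zmodChar_apply, hg1]
      ring
  have h3 : ∀ (L : List (K × K →+ ZMod p)) (v : K × K),
      ζ - 1 ∣ (L.map fun l => g (l v).val).prod - ((L.map fun l => (l v).val).prod : ℕ) := by
    intro L v
    induction L with
    | nil => simp
    | cons l L ih =>
      simp only [List.map_cons, List.prod_cons, Nat.cast_mul]
      obtain ⟨a, ha⟩ := ih
      obtain ⟨b, hb⟩ := hg2 (l v).val
      refine ⟨g (l v).val * a + b * ((L.map fun l => (l v).val).prod : ℕ), ?_⟩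
      linear_combination g (l v).val * ha + ((L.map fun l => (l v).val).prod : ℕ) * hb
  simp only [AddChar.zero_apply, one_mul, h2] at h1
  rw [← Finset.mul_sum] at h1
  -- Since |L| < nh, cancelling (ζ - 1)^|L| leaves at least one factor ζ - 1.
  have h4 : ζ - 1 ∣ ∑ x, (L.map fun l => g (l (x, F x)).val).prod := by
    have h5 : (ζ - 1) ^ (L.length + 1) ∣ (ζ - 1) ^ L.length *
        ∑ x, (L.map fun l => g (l (x, F x)).val).prod := (pow_dvd_pow _ hL).trans h1
    rw [pow_succ] at h5
    exact (mul_dvd_mul_iff_left (pow_ne_zero _ hπ.ne_zero)).1 h5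
  have h5 : ζ - 1 ∣ ((∑ x, (L.map fun l => (l (x, F x)).val).prod : ℕ) : R) := by
    rw [Nat.cast_sum]
    have := dvd_sub h4 (Finset.dvd_sum fun x (_ : x ∈ Finset.univ) => h3 L (x, F x))
    rwa [Finset.sum_sub_distrib, sub_sub_cancel] at this
  have h6 := natCast_eq_zero_of_sub_one_dvd (p := p) hπ
    ((dvd_pow_self _ (Nat.sub_ne_zero_of_lt hp0.one_lt)).trans hassoc.dvd) h5
  rw [Nat.cast_sum] at h6
  rw [← h6]
  refine Finset.sum_congr rfl fun x _ => ?_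
  rw [Nat.cast_list_prod, List.map_map]
  congr 1
  exact List.map_congr_left fun l _ => by simp

/-! ### Vanishing moments over K -/

open scoped Pointwise in
/-- Products of few additive self-maps of the field sum to zero over the graph of a planar
function. -/
theorem IsPlanarFunction.sum_prod_eq_zero {K : Type*} [Field K] [Fintype K] {p n h : ℕ}
    [Fact p.Prime] [CharP K p] (hK : Fintype.card K = p ^ n) (hp : p - 1 = 2 * h) {F : K → K}
    (hF : IsPlanarFunction F) (L : List (K × K →+ K)) (hL : L.length < n * h) :
    ∑ x, (L.map fun l => l (x, F x)).prod = 0 := by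
  let _ : Algebra (ZMod p) K := ZMod.algebra K p
  let S : Set (K → K) :=
    Set.range fun (l : K × K →+ ZMod p) (x : K) => algebraMap (ZMod p) K (l (x, F x))
  -- Coordinates in an 𝔽_p-basis of K reduce to 𝔽_p-valued functionals.
  have hS : ∀ l : K × K →+ K, (fun x => l (x, F x)) ∈ Submodule.span K S := by
    intro l
    let b := Module.finBasis (ZMod p) K
    have h1 : (fun x => l (x, F x)) = ∑ i, b i • fun x : K =>
        algebraMap (ZMod p) K (((b.coord i).toAddMonoidHom.comp l) (x, F x)) := by
      ext x
      simp only [Finset.sum_apply, Pi.smul_apply, smul_eq_mul]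
      conv_lhs => rw [← b.sum_repr (l (x, F x))]
      refine Finset.sum_congr rfl fun i _ => ?_
      rw [Algebra.smul_def, mul_comm]
      rfl
    rw [h1]
    exact Submodule.sum_mem _ fun i _ => Submodule.smul_mem _ _ (Submodule.subset_span ⟨_, rfl⟩)
  have hprod : (fun x => (L.map fun l => l (x, F x)).prod) ∈ Submodule.span K S ^ L.length := by
    clear hL
    induction L with
    | nil => exact Submodule.one_le.1 le_rfl
    | cons l L ih =>
      rw [List.length_cons, pow_succ']
      exact Submodule.mul_mem_mul (hS l) ih
  rw [Submodule.span_pow] at hprod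
  let T : (K → K) →ₗ[K] K := ∑ x, LinearMap.proj x
  have hT : ∀ f, T f = ∑ x, f x := fun f => by simp [T]
  suffices h1 : Submodule.span K (S ^ L.length) ≤ LinearMap.ker T by
    have := h1 hprod
    rwa [LinearMap.mem_ker, hT] at this
  rw [Submodule.span_le]
  intro f hf
  obtain ⟨u, rfl⟩ := Set.mem_pow.1 hf
  choose l hl using fun i => (u i).2
  have h1 := hF.sum_prod_functional_eq_zero hK hp (List.ofFn l) (by simpa using hL)
  rw [SetLike.mem_coe, LinearMap.mem_ker, hT, ← map_zero (algebraMap (ZMod p) K), ← h1, map_sum]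
  refine Finset.sum_congr rfl fun x _ => ?_
  simp only [List.map_ofFn, List.prod_ofFn, map_prod, Finset.prod_apply, ← hl, Function.comp]

/-- Power moments of low `p`-weight over the graph of a planar function vanish. -/
theorem IsPlanarFunction.sum_pow_mul_pow_eq_zero {K : Type*} [Field K] [Fintype K] {p n h : ℕ}
    [Fact p.Prime] [CharP K p] (hK : Fintype.card K = p ^ n) (hp : p - 1 = 2 * h) {F : K → K}
    (hF : IsPlanarFunction F) {k : ℕ} (a b : Fin k → ℕ) (hab : ∑ i, a i + ∑ i, b i < n * h) :
    ∑ x, x ^ (∑ i, a i * p ^ (i : ℕ)) * F x ^ (∑ i, b i * p ^ (i : ℕ)) = 0 := by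
  let φ : ℕ → K →+ K := fun i => (iterateFrobenius K p i : K →+* K).toAddMonoidHom
  let L : List (K × K →+ K) :=
    (List.ofFn fun i : Fin k =>
      List.replicate (a i) ((φ i).comp (AddMonoidHom.fst K K))).flatten ++
    (List.ofFn fun i : Fin k =>
      List.replicate (b i) ((φ i).comp (AddMonoidHom.snd K K))).flatten
  have h1 := hF.sum_prod_eq_zero hK hp L (by
    simpa [L, List.length_flatten, List.map_ofFn, List.sum_ofFn, Function.comp_def] using hab)
  rw [← h1]
  refine Finset.sum_congr rfl fun x _ => ?_
  simp only [L, List.map_append, List.prod_append, List.map_flatten, List.prod_flatten,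
    List.map_ofFn, List.prod_ofFn, Function.comp_def, List.map_replicate, List.prod_replicate]
  rw [← Finset.prod_pow_eq_pow_sum, ← Finset.prod_pow_eq_pow_sum]
  congr 1 <;> refine Finset.prod_congr rfl fun i _ => ?_
  · simp [φ, iterateFrobenius_def, ← pow_mul, mul_comm]
  · simp [φ, iterateFrobenius_def, ← pow_mul, mul_comm]

/-! ### Planar power maps and the prime field -/

/-- The sum of the `e`-th powers over a finite field is `-1` for positive multiples `e` of
`q - 1`. -/
theorem FiniteField.sum_pow_of_card_sub_one_dvd {K : Type*} [Field K] [Fintype K] {e : ℕ}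
    (he : 0 < e) (h : Fintype.card K - 1 ∣ e) : ∑ x : K, x ^ e = -1 := by
  classical
  obtain ⟨c, rfl⟩ := h
  have h1 : ∀ x : K, x ^ ((Fintype.card K - 1) * c) = 1 - if x = 0 then 1 else 0 := by
    intro x
    split_ifs with hx
    · rw [hx, zero_pow he.ne', sub_self]
    · rw [pow_mul, FiniteField.pow_card_sub_one_eq_one x hx, one_pow, sub_zero]
  simp [h1]

/-- A planar power map restricts to a planar power map of the prime field. -/
theorem IsPlanarFunction.pow_zmod {K : Type*} [Field K] {p : ℕ} [Fact p.Prime] [CharP K p] {d : ℕ}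
    (h : IsPlanarFunction fun x : K => x ^ d) : IsPlanarFunction fun x : ZMod p => x ^ d := by
  intro α hα
  let ι : ZMod p →+* K := ZMod.castHom dvd_rfl K
  refine Finite.injective_iff_bijective.1 fun x y hxy => ?_
  refine ι.injective ((h (ι α) ((map_ne_zero ι).2 hα)).1 ?_)
  simpa using congrArg ι hxy

/-- Exponents of planar power maps are even. -/
theorem IsPlanarFunction.even_of_pow {K : Type*} [Field K] {d : ℕ}
    (h : IsPlanarFunction fun x : K => x ^ d) : Even d := by
  by_contra hd
  rw [Nat.not_even_iff_odd] at hd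
  have h1 := (h 1 one_ne_zero).1 (a₁ := 0) (a₂ := -1) (by
    simp [hd.neg_one_pow, hd.pos.ne'])
  simp at h1

/-- Planar power maps of a prime field have exponent congruent to two. -/
theorem IsPlanarFunction.dvd_sub_two_of_pow_zmod {p : ℕ} [Fact p.Prime] (hp2 : p ≠ 2) {d : ℕ}
    (hd : 2 ≤ d) (h : IsPlanarFunction fun x : ZMod p => x ^ d) : p - 1 ∣ d - 2 := by
  have hp : p.Prime := Fact.out
  have hp3 : 3 ≤ p := by have := hp.two_le; omega
  obtain ⟨m, hm⟩ : ∃ m, p - 1 = 2 * m := by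
    obtain ⟨c, hc⟩ := hp.odd_of_ne_two hp2
    exact ⟨c, by omega⟩
  have hcast : ∀ c : ℕ, 0 < c → c < p → (c : ZMod p) ≠ 0 := fun c h0 h1 hc =>
    absurd (Nat.le_of_dvd h0 ((ZMod.natCast_eq_zero_iff c p).1 hc)) (by omega)
  have htwo : (2 : ZMod p) ≠ 0 := by exact_mod_cast hcast 2 (by omega) (by omega)
  have hdeven := h.even_of_pow
  have hred : ∀ x : ZMod p, x ≠ 0 → x ^ d = x ^ (d % (p - 1)) := by
    intro x hx
    conv_lhs => rw [← Nat.mod_add_div d (p - 1), pow_add, pow_mul, ZMod.pow_card_sub_one_eq_one hx,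
      one_pow, mul_one]
  set e := d % (p - 1)
  have hde : d = e + (p - 1) * (d / (p - 1)) := (Nat.mod_add_div d (p - 1)).symm
  set t := d / (p - 1)
  have hlt : e < p - 1 := Nat.mod_lt _ (by omega)
  have heven : ∃ e', e = 2 * e' := by
    obtain ⟨c, hc⟩ := hdeven
    refine ⟨c - m * t, ?_⟩
    rw [hm, mul_assoc] at hde
    omega
  obtain ⟨e', he'⟩ := heven
  by_cases hp3' : p = 3
  · subst hp3'
    obtain ⟨c, hc⟩ := hdeven
    exact ⟨c - 1, by omega⟩
  have hp5 : 5 ≤ p := by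
    by_contra hlt
    have : p = 4 := by omega
    subst this
    exact absurd hp (by norm_num)
  by_cases he0 : e = 0
  · exfalso
    have h2 := (h 1 one_ne_zero).1 (a₁ := 1) (a₂ := 2) (by
      have h3 : (3 : ZMod p) ≠ 0 := by exact_mod_cast hcast 3 (by omega) (by omega)
      have e1 := hred 2 htwo
      have e2 := hred 3 h3
      rw [he0, pow_zero] at e1 e2
      norm_num [e1, e2])
    have : (1 : ZMod p) = 0 := by linear_combination -h2
    exact one_ne_zero this
  by_cases he2 : e = 2
  · refine ⟨t, ?_⟩
    omega
  exfalso
  -- r + dj is a positive multiple of p - 1, so the moment x^r F^j equals -1 and must have weight r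
  -- + j ≥ m.
  set j := (p - 1) / e
  set r := (p - 1) % e
  have hjr : r + e * j = p - 1 := Nat.mod_add_div _ _
  have hr : r < e := Nat.mod_lt _ (by omega)
  have hj : 1 ≤ j := Nat.div_pos hlt.le (by omega)
  have hreven : r ≠ e - 1 := by
    have : e * j = 2 * (e' * j) := by rw [he', mul_assoc]
    omega
  have hweight : m ≤ r + j := by
    by_contra hlt
    have h1 := h.sum_pow_mul_pow_eq_zero (n := 1) (h := m) (by rw [ZMod.card, pow_one]) hm
      (fun _ : Fin 1 => r) (fun _ : Fin 1 => j) (by simpa using hlt)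
    have h2 := FiniteField.sum_pow_of_card_sub_one_dvd (K := ZMod p) (e := r + d * j)
      (by have := Nat.mul_pos (show 0 < d by omega) hj; omega)
      (by
        rw [ZMod.card]
        refine ⟨1 + t * j, ?_⟩
        have : r + d * j = (r + e * j) + (p - 1) * (t * j) := by rw [hde]; ring
        rw [this, hjr]
        ring)
    simp only [Finset.univ_unique, Fin.default_eq_zero, Finset.sum_singleton, Fin.val_zero,
      pow_zero, mul_one, ← pow_mul, ← pow_add] at h1
    rw [h1] at h2
    exact one_ne_zero (neg_eq_zero.1 h2.symm)
  have hj1 : j = 1 := by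
    by_contra hj1
    obtain ⟨i, hi⟩ : ∃ i, j = i + 2 := ⟨j - 2, by omega⟩
    obtain ⟨f, hf⟩ : ∃ f, e = f + 4 := ⟨e - 4, by omega⟩
    rw [hi, hf] at hjr
    have : (f + 4) * (i + 2) = f * i + 2 * f + 4 * i + 8 := by ring
    have : 0 ≤ f * i := Nat.zero_le _
    omega
  have hpe : p = 2 * e - 1 := by
    rw [hj1] at hjr hweight
    omega
  have h4 : (4 : ZMod p) ≠ 0 := by exact_mod_cast hcast 4 (by omega) (by omega)
  have h3 : (3 : ZMod p) ≠ 0 := by exact_mod_cast hcast 3 (by omega) (by omega)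
  have h5 : (5 : ZMod p) ≠ 0 := by exact_mod_cast hcast 5 (by omega) (by omega)
  -- Here e = (p + 1)/2, so x^d fixes nonzero squares; the triple 3, 4, 5 then gives a collision
  -- with 0.
  have hsq : ∀ y : ZMod p, y ≠ 0 → (y ^ 2) ^ d = y ^ 2 := by
    intro y hy
    rw [hred _ (pow_ne_zero 2 hy), ← pow_mul, show 2 * e = (p - 1) + 2 by omega, pow_add,
      ZMod.pow_card_sub_one_eq_one hy, one_mul]
  have h34 := hsq (3 / 4) (div_ne_zero h3 h4)
  have h54 := hsq (5 / 4) (div_ne_zero h5 h4)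
  have hadd : (3 / 4 : ZMod p) ^ 2 + 1 = (5 / 4) ^ 2 := by
    field_simp
    norm_num
  have h6 := (h 1 one_ne_zero).1 (a₁ := (3 / 4) ^ 2) (a₂ := 0) (by
    beta_reduce
    rw [hadd, h34, h54, ← hadd, zero_add, zero_pow (by omega : d ≠ 0)]
    ring)
  exact pow_ne_zero 2 (div_ne_zero h3 h4) h6

theorem mainTheorem7 (p n : ℕ) (hp : p.Prime) (hn : 2 ≤ n)
    {K : Type*} [Field K] [Finite K] (hK : Nat.card K = p ^ n)
    (d : ℕ) (a : Fin n → ℕ) (hd : IsBaseRepr p n d a) (ha : ∀ i, 1 < a i) :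
    ¬ IsPlanarPolynomial (Polynomial.X ^ d : Polynomial K) := by
  intro hplanar
  have hF : IsPlanarFunction fun x : K => x ^ d := by
    simpa [IsPlanarPolynomial] using hplanar
  have : Fact p.Prime := ⟨hp⟩
  let _ : Fintype K := Fintype.ofFinite K
  rw [Nat.card_eq_fintype_card] at hK
  have hchar : CharP K p := by
    obtain ⟨q, hq⟩ := CharP.exists K
    obtain ⟨k, hqp, hk⟩ := FiniteField.card K q
    rw [hK] at hk
    have : p = q := (Nat.prime_dvd_prime_iff_eq hp hqp).1
      (hp.dvd_of_dvd_pow (hk ▸ dvd_pow_self p (by omega)))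
    exact this ▸ hq
  obtain ⟨hlt, hd⟩ := hd
  obtain ⟨k, rfl⟩ : ∃ k, n = k + 1 := ⟨n - 1, by omega⟩
  have hp3 : p ≠ 2 := by have := hlt 0; have := ha 0; omega
  obtain ⟨m, hm⟩ : ∃ m, p - 1 = 2 * m := by
    obtain ⟨c, hc⟩ := hp.odd_of_ne_two hp3
    exact ⟨c, by omega⟩
  set N := ∑ i : Fin (k + 1), p ^ (i : ℕ) with hN
  have hgeom : N * (p - 1) = p ^ (k + 1) - 1 := by
    rw [hN, Fin.sum_univ_eq_sum_range (fun i => p ^ i), Nat.geomSum_eq hp.two_le,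
      Nat.div_mul_cancel (Nat.sub_one_dvd_pow_sub_one p (k + 1))]
  have hqpos : 1 ≤ p ^ (k + 1) := Nat.one_le_pow _ _ hp.pos
  have hNk : k + 1 ≤ N := by
    simpa using Finset.card_nsmul_le_sum Finset.univ (fun i : Fin (k + 1) => p ^ (i : ℕ)) 1
      fun i _ => Nat.one_le_pow _ _ hp.pos
  have hsplit : d = ∑ i, (a i - 2) * p ^ (i : ℕ) + 2 * N := by
    rw [hd, hN, Finset.mul_sum, ← Finset.sum_add_distrib]
    refine Finset.sum_congr rfl fun i _ => ?_
    rw [← add_mul, Nat.sub_add_cancel (ha i)]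
  have hdvd := hF.pow_zmod.dvd_sub_two_of_pow_zmod (p := p) hp3 (by omega)
  have hone : ∑ i : Fin (k + 1), (if i = 0 then 1 else 0) * p ^ (i : ℕ) = 1 := by simp
  -- Pair A = q - 1 - d, B = 1.
  have hupper : ∑ i, a i ≤ (k + 1) * m + 1 := by
    by_contra hgt
    have hs : ∑ i, (p - 1 - a i) + ∑ i, a i = (k + 1) * (p - 1) := by
      rw [← Finset.sum_add_distrib]
      simp [Nat.sub_add_cancel (Nat.le_sub_one_of_lt (hlt _))]
    have h1 := hF.sum_pow_mul_pow_eq_zero (h := m) hK hm (fun i => p - 1 - a i)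
      (fun i => if i = 0 then 1 else 0) (by
        rw [hm] at hs
        have : (k + 1) * (2 * m) = 2 * ((k + 1) * m) := by ring
        simp only [Finset.sum_ite_eq', Finset.mem_univ, if_true]
        rw [hm]
        omega)
    have h2 : ∑ i, (p - 1 - a i) * p ^ (i : ℕ) + d = p ^ (k + 1) - 1 := by
      rw [hd, ← Finset.sum_add_distrib, ← hgeom, hN, Finset.sum_mul]
      refine Finset.sum_congr rfl fun i _ => ?_
      rw [← add_mul, Nat.sub_add_cancel (Nat.le_sub_one_of_lt (hlt _)), mul_comm]
    simp_rw [hone, pow_one, ← pow_add, h2] at h1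
    rw [FiniteField.sum_pow_of_card_sub_one_dvd (by omega) (by rw [hK])] at h1
    exact one_ne_zero (neg_eq_zero.1 h1)
  -- Pair A = d - 2N, B = N - 1: digits of d exceed 1, so A has digits a i - 2, and A + dB = (d -
  -- 2)N is divisible by (p - 1)N = q - 1.
  have hlower : (k + 1) * m ≤ ∑ i, (a i - 2) + k := by
    by_contra hgt
    have h1 := hF.sum_pow_mul_pow_eq_zero (h := m) hK hm (fun i => a i - 2)
      (fun i => if i = 0 then 0 else 1) (by
        have : ∑ i : Fin (k + 1), (if i = 0 then 0 else 1) = k := by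
          simp [Fin.sum_univ_succ]
        change ∑ i, (a i - 2) + ∑ i : Fin (k + 1), (if i = 0 then 0 else 1) < _
        omega)
    have h2 : ∑ i : Fin (k + 1), (if i = 0 then 0 else 1) * p ^ (i : ℕ) = N - 1 := by
      rw [hN, Fin.sum_univ_succ, Fin.sum_univ_succ]
      simp
    have h3 : ∑ i, (a i - 2) * p ^ (i : ℕ) + d * (N - 1) = (d - 2) * N := by
      have e1 : d * (N - 1) + d = d * N := by
        rw [← Nat.mul_succ]; congr 1; omega
      have e2 : (d - 2) * N + 2 * N = d * N := by
        rw [← add_mul]; congr 1; omega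
      omega
    simp_rw [h2, ← pow_mul, ← pow_add, h3] at h1
    rw [FiniteField.sum_pow_of_card_sub_one_dvd (Nat.mul_pos (by omega) (by omega))
      (by rw [hK, ← hgeom, mul_comm N]; exact mul_dvd_mul_right hdvd N)] at h1
    exact one_ne_zero (neg_eq_zero.1 h1)
  have hsum : ∑ i, (a i - 2) + 2 * (k + 1) = ∑ i, a i := by
    have : 2 * (k + 1) = ∑ i : Fin (k + 1), 2 := by simp [mul_comm]
    rw [this, ← Finset.sum_add_distrib]
    exact Finset.sum_congr rfl fun i _ => Nat.sub_add_cancel (ha i)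
  omega
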